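/- Let $\mathbb{F}$ be $\mathbb{R}$ or $\mathbb{C}$; the rational scalars are the elements of $\mathbb{F} \cap \mathbb{Q}(i)$. A presentation of a Banach space $\mathcal{B}$ over $\mathbb{F}$ is a sequence $(v_j)_{j \in \mathbb{N}}$ of vectors whose closed linear span is $\mathcal{B}$. It is computable if there is an algorithm that, given $k \in \mathbb{N}$ and a finite sequence $\alpha_0, \ldots, \alpha_{m-1}$ of rational scalars, computes a rational number $q$ with $\left| q - \left\| \sum_{j < m} \alpha_j v_j \right\|_{\mathcal{B}} \right| < 2^{-k}$. The space $\mathcal{B}$ is computably presentable if it has a computable presentation. A real number $x$ is computable if there is an algorithm that, given $k \in \mathbb{N}$, computes a rational number $q$ with $|q - x| < 2^{-k}$. For $1 \leq p < \infty$, let $\ell^p_n$ be $\mathbb{F}^n$ with the norm $\|x\|_p = \left( \sum_{i=1}^n |x_i|^p \right)^{1/p}$. Let $n \geq 2$ be an integer and let $p$ be a real number with $1 \leq p < \infty$. If $\ell^p_n$ is computably presentable, then $p$ is computable. -/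

import Mathlib

/-- Codes of rational numbers: `(a, b, d)` codes the rational number `(a - b) / (d + 1)`. -/
abbrev RatCode : Type := ℕ × ℕ × ℕ

/-- The rational number with a given code. -/
def RatCode.val (c : RatCode) : ℚ := ((c.1 : ℚ) - (c.2.1 : ℚ)) / ((c.2.2 : ℚ) + 1)

/-- Every rational number has a code. -/
theorem RatCode.val_surjective : Function.Surjective RatCode.val := by
  intro q
  refine ⟨(q.num.toNat, (-q.num).toNat, q.den - 1), ?_⟩
  have h1 : ((q.num.toNat : ℚ) - ((-q.num).toNat : ℚ)) = (q.num : ℚ) := by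
    have : ((q.num.toNat : ℤ) - ((-q.num).toNat : ℤ)) = q.num := by omega
    exact_mod_cast this
  have h2 : (((q.den - 1 : ℕ) : ℚ) + 1) = (q.den : ℚ) := by
    have : q.den - 1 + 1 = q.den := Nat.succ_pred_eq_of_pos q.pos
    exact_mod_cast this
  simp only [RatCode.val, h1, h2]
  exact Rat.num_div_den q

/-- A real number `x` is computable if there is an algorithm that, given `k`, computes (a code of)
a rational number `q` with `|q - x| < 2⁻ᵏ`. -/
def IsComputableReal (x : ℝ) : Prop :=
  ∃ f : ℕ → RatCode, Computable f ∧ ∀ k : ℕ, |((f k).val : ℝ) - x| < 1 / 2 ^ k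

/-- Codes of rational scalars. -/
abbrev ScalarCode : Type := RatCode × RatCode

/-- The rational scalar with a given code: `(x, y)` codes `x + y i`. Over `ℂ` the rational scalars
are the elements of `ℚ(i)`. Over `ℝ` one has `RCLike.I = 0`, so the second component of the code is
ignored and the rational scalars are the elements of `ℚ`. -/
noncomputable def ScalarCode.val (𝕜 : Type*) [RCLike 𝕜] (c : ScalarCode) : 𝕜 :=
  ((c.1.val : ℚ) : 𝕜) + ((c.2.val : ℚ) : 𝕜) * RCLike.I

/-- A presentation of a Banach space `B`: a sequence of (distinguished) vectors whose closed linear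
span is `B`. -/
structure BanachPresentation (𝕜 : Type*) [RCLike 𝕜] (B : Type*) [NormedAddCommGroup B]
    [NormedSpace 𝕜 B] [CompleteSpace B] where
  /-- The `j`-th distinguished vector. -/
  vec : ℕ → B
  linearly_dense : (Submodule.span 𝕜 (Set.range vec)).topologicalClosure = ⊤

/-- The rational vector `∑_{j < |α|} α(j) v_j` of a presentation that is coded by the finite
sequence `α` of rational scalars. -/
noncomputable def BanachPresentation.ratVec {𝕜 : Type*} [RCLike 𝕜] {B : Type*}
    [NormedAddCommGroup B] [NormedSpace 𝕜 B] [CompleteSpace B] (P : BanachPresentation 𝕜 B)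
    (α : List ScalarCode) : B :=
  ∑ j : Fin α.length, (α.get j).val 𝕜 • P.vec j

/-- A presentation is computable if there is an algorithm that, given `k` and a code of a rational
vector `v`, computes (a code of) a rational number `q` with `|q - ‖v‖| < 2⁻ᵏ`. -/
def BanachPresentation.IsComputable {𝕜 : Type*} [RCLike 𝕜] {B : Type*} [NormedAddCommGroup B]
    [NormedSpace 𝕜 B] [CompleteSpace B] (P : BanachPresentation 𝕜 B) : Prop :=
  ∃ f : ℕ → List ScalarCode → RatCode, Computable₂ f ∧
    ∀ (k : ℕ) (α : List ScalarCode), |((f k α).val : ℝ) - ‖P.ratVec α‖| < 1 / 2 ^ k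

/-- A Banach space is computably presentable if it has a computable presentation. -/
def IsComputablyPresentable (𝕜 : Type*) [RCLike 𝕜] (B : Type*) [NormedAddCommGroup B]
    [NormedSpace 𝕜 B] [CompleteSpace B] : Prop :=
  ∃ P : BanachPresentation 𝕜 B, P.IsComputable

instance fact_one_le_ofReal (p : ℝ) [hp : Fact (1 ≤ p)] : Fact (1 ≤ ENNReal.ofReal p) :=
  ⟨by rw [← ENNReal.ofReal_one]; exact ENNReal.ofReal_le_ofReal hp.out⟩

/-- The space `ℓ^p_n` over `𝕜`: the space `𝕜ⁿ` with the `p`-norm. -/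
abbrev FiniteEllp (𝕜 : Type*) [RCLike 𝕜] (p : ℝ) (n : ℕ) : Type _ :=
  PiLp (ENNReal.ofReal p) (fun _ : Fin n => 𝕜)

/-! The exponent is recovered from an isometric invariant, so that no information about the standard
basis is needed: the James constant, the supremum of `min ‖x + y‖ ‖x - y‖` over the unit ball. For
two or more coordinates it equals `2 ^ (1 / p)` when `p ≤ 2` and `2 ^ (1 - 1 / p)` when `2 ≤ p`. The
upper bounds are Clarkson's inequalities, and explicit pairs attain them
(`FiniteEllp.hasJamesExponent_of_le_two`, `FiniteEllp.hasJamesExponent_of_two_le`).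

In finite dimension the constant can be read off any computable presentation. Finitely many
distinguished vectors span the space, and their Gaussian-integer combinations form a net of bounded
mesh (`exists_lattice_pair_near`). Scaling the unit ball by a large `M` replaces ever finer
approximation: norms within a fixed error, rounded to natural numbers, suffice, because fixed errors
are negligible against `M`. Comparing the constant with `2 ^ (b / a)` becomes a comparison of
integers after raising to the power `a`. A single good pair certifies a lower bound, and a check of
the whole finite net certifies an upper bound (`HasJamesExponent.hasComputableCuts`).

Semidecidable cuts of `1 / p` or `1 - 1 / p` give those of `p`, and a search for a narrow enclosing
interval then computes `p`. The spanning length, the net constants and the side of `2` on which `p`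
lies are only shown to exist, which is enough for an algorithm to exist. -/

/-! ### Computable arithmetic, bounded quantifiers and unbounded search. -/

theorem primrec_nat_pow : Primrec₂ ((· ^ ·) : ℕ → ℕ → ℕ) :=
  Primrec₂.unpaired'.1 Nat.Primrec.pow

theorem Computable.nat_pow {α : Type*} [Primcodable α] {f g : α → ℕ} (hf : Computable f)
    (hg : Computable g) : Computable fun a => f a ^ g a :=
  primrec_nat_pow.to_comp.comp hf hg

theorem computable_decide_lt {α : Type*} [Primcodable α] {f g : α → ℕ} (hf : Computable f)
    (hg : Computable g) : Computable fun a => decide (f a < g a) :=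
  Primrec.nat_lt.decide.to_comp.comp hf hg

theorem computable_decide_le {α : Type*} [Primcodable α] {f g : α → ℕ} (hf : Computable f)
    (hg : Computable g) : Computable fun a => decide (f a ≤ g a) :=
  Primrec.nat_le.decide.to_comp.comp hf hg

theorem computable_forall_lt {α : Type*} [Primcodable α] {b : α → ℕ} {t : α → ℕ → Bool}
    (hb : Computable b) (ht : Computable₂ t) :
    Computable fun a => decide (∀ i < b a, t a i = true) := by
  have h : Computable fun a => Nat.rec (motive := fun _ => Bool) true
      (fun y IH => IH && t a y) (b a) :=
    Computable.nat_rec hb (Computable.const true)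
      (Primrec.and.to_comp.comp (Computable.snd.comp Computable.snd)
        (ht.comp Computable.fst (Computable.fst.comp Computable.snd))).to₂
  refine h.of_eq fun a => ?_
  induction b a with
  | zero => simp
  | succ n ih =>
    simp only [ih, Nat.forall_lt_succ_right, Bool.decide_and, Bool.decide_eq_true]

/-- Unbounded search for a witness of a computable predicate that always has one. -/
theorem Computable₂.exists_computable_choice {α β : Type*} [Primcodable α] [Primcodable β]
    {g : α → β → Bool} (hg : Computable₂ g) (h : ∀ a, ∃ t, g a t = true) :
    ∃ F : α → β, Computable F ∧ ∀ a, g a (F a) = true := by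
  let s : α → ℕ → Option β := fun a m => (Encodable.decode (α := β) m).bind
    fun t => cond (g a t) (some t) none
  have hs : Computable₂ s :=
    Computable.option_bind (Computable.decode.comp Computable.snd)
      (Computable.cond (hg.comp (Computable.fst.comp Computable.fst) Computable.snd)
        (Computable.option_some.comp Computable.snd) (Computable.const none)).to₂
  have hdom : ∀ a, (Nat.rfindOpt (s a)).Dom := fun a => by
    obtain ⟨t, ht⟩ := h a
    exact Nat.rfindOpt_dom.2 ⟨Encodable.encode t, t, by simp [s, ht]⟩
  refine ⟨fun a => (Nat.rfindOpt (s a)).get (hdom a),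
    (Partrec.rfindOpt hs).of_eq_tot fun a => Part.get_mem _, fun a => ?_⟩
  obtain ⟨m, hm⟩ := Nat.rfindOpt_spec (Part.get_mem (hdom a))
  beta_reduce
  generalize (Nat.rfindOpt (s a)).get (hdom a) = r at hm ⊢
  simp only [s, Option.mem_def, Option.bind_eq_some_iff] at hm
  obtain ⟨t, -, ht⟩ := hm
  cases hgt : g a t <;> simp_all

/-! ### Computing a real number from semidecidable cuts. -/

/-- A real number greater than one whose left and right cuts among the rationals
`1 + e / (d + 1)` are semidecidable is computable. -/
theorem IsComputableReal.of_cuts {x : ℝ} (hx : 1 < x) {A B : ℕ × ℕ → ℕ → Bool}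
    (hA : Computable₂ A) (hB : Computable₂ B)
    (hA₁ : ∀ e d w, A (e, d) w = true → 1 + (e : ℝ) / (d + 1) ≤ x)
    (hA₂ : ∀ e d : ℕ, 1 + (e : ℝ) / (d + 1) < x → ∃ w, A (e, d) w = true)
    (hB₁ : ∀ e d w, B (e, d) w = true → x ≤ 1 + (e : ℝ) / (d + 1))
    (hB₂ : ∀ e d : ℕ, x < 1 + (e : ℝ) / (d + 1) → ∃ w, B (e, d) w = true) :
    IsComputableReal x := by
  -- A tuple `(e, e', d, w, w')` holds the two numerators of an enclosing interval, their common
  -- denominator `d + 1`, and the certificates for both ends.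
  let T : Type := ℕ × ℕ × ℕ × ℕ × ℕ
  let g : ℕ → T → Bool := fun k t =>
    (A (t.1, t.2.2.1) t.2.2.2.1 && B (t.2.1, t.2.2.1) t.2.2.2.2) &&
      decide ((t.2.1 - t.1) * 2 ^ k < t.2.2.1 + 1)
  have hg : Computable₂ g := by
    have k : Computable fun z : ℕ × T => z.1 := Computable.fst
    have e : Computable fun z : ℕ × T => z.2.1 := Computable.fst.comp Computable.snd
    have r : Computable fun z : ℕ × T => z.2.2 := Computable.snd.comp Computable.snd
    have e' : Computable fun z : ℕ × T => z.2.2.1 := Computable.fst.comp r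
    have r' : Computable fun z : ℕ × T => z.2.2.2 := Computable.snd.comp r
    have d : Computable fun z : ℕ × T => z.2.2.2.1 := Computable.fst.comp r'
    have r'' : Computable fun z : ℕ × T => z.2.2.2.2 := Computable.snd.comp r'
    have w : Computable fun z : ℕ × T => z.2.2.2.2.1 := Computable.fst.comp r''
    have w' : Computable fun z : ℕ × T => z.2.2.2.2.2 := Computable.snd.comp r''
    exact Primrec.and.to_comp.comp (Primrec.and.to_comp.comp (hA.comp (e.pair d) w)
      (hB.comp (e'.pair d) w')) (computable_decide_lt (Primrec.nat_mul.to_comp.comp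
        (Primrec.nat_sub.to_comp.comp e' e) (Computable.nat_pow (Computable.const 2) k))
        (Computable.succ.comp d))
  have hex : ∀ k, ∃ t, g k t = true := by
    intro k
    -- Certificates exist only for strict inequalities, so the ends must avoid `x` even if it is a
    -- grid point. Ceiling minus one and floor plus one do so at distance at most two grid steps,
    -- whence the factor 2.
    let d := 2 * 2 ^ k
    have hd : (0 : ℝ) < (d : ℝ) + 1 := by positivity
    have hy : 0 < (x - 1) * (d + 1) := mul_pos (by linarith) hd
    let e := ⌈(x - 1) * (d + 1)⌉₊ - 1
    let e' := ⌊(x - 1) * (d + 1)⌋₊ + 1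
    have hc : 0 < ⌈(x - 1) * (d + 1)⌉₊ := Nat.ceil_pos.2 hy
    have he : (e : ℝ) < (x - 1) * (d + 1) := by
      refine Nat.lt_ceil.1 ?_
      simp only [e]
      omega
    have he' : (x - 1) * (d + 1) < (e' : ℝ) := by
      simpa [e'] using Nat.lt_floor_add_one ((x - 1) * (d + 1))
    have hee : e' - e ≤ 2 := by
      have := Nat.floor_le_ceil ((x - 1) * (d + 1))
      simp only [e, e']
      omega
    obtain ⟨w, hw⟩ := hA₂ e d (by rw [← lt_sub_iff_add_lt', div_lt_iff₀ hd]; exact he)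
    obtain ⟨w', hw'⟩ := hB₂ e' d (by rw [← sub_lt_iff_lt_add', lt_div_iff₀ hd]; exact he')
    refine ⟨(e, e', d, w, w'), ?_⟩
    have h1 : (e' - e) * 2 ^ k ≤ d := Nat.mul_le_mul_right _ hee
    simpa [g, hw, hw'] using h1
  obtain ⟨t, ht, hspec⟩ := hg.exists_computable_choice hex
  have hd : Computable fun k => (t k).2.2.1 :=
    Computable.fst.comp (Computable.snd.comp (Computable.snd.comp ht))
  refine ⟨fun k => ((t k).2.2.1 + 1 + (t k).1, 0, (t k).2.2.1),
    (Primrec.nat_add.to_comp.comp (Computable.succ.comp hd) (Computable.fst.comp ht)).pair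
      ((Computable.const 0).pair hd), fun k => ?_⟩
  have h := hspec k
  beta_reduce
  generalize t k = s at h ⊢
  obtain ⟨e, e', d, w, w'⟩ := s
  simp only [g, Bool.and_eq_true, decide_eq_true_eq] at h
  obtain ⟨⟨h1, h2⟩, h3⟩ := h
  replace h1 := hA₁ _ _ _ h1
  replace h2 := hB₁ _ _ _ h2
  have hd : (0 : ℝ) < (d : ℝ) + 1 := by positivity
  have hk : (0 : ℝ) < 2 ^ k := by positivity
  have h4 : ((e' : ℝ) - e) * 2 ^ k < d + 1 := by
    have h3' : ((e' - e : ℕ) : ℝ) * 2 ^ k < (d : ℝ) + 1 := by exact_mod_cast h3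
    refine lt_of_le_of_lt (mul_le_mul_of_nonneg_right ?_ hk.le) h3'
    · have : (e' : ℝ) ≤ ((e' - e : ℕ) : ℝ) + e := by exact_mod_cast le_tsub_add
      linarith
  have h5 : (e' : ℝ) / (d + 1) - (e : ℝ) / (d + 1) < 1 / 2 ^ k := by
    rw [← sub_div, div_lt_div_iff₀ hd hk]
    linarith
  have h6 : ((RatCode.val (d + 1 + e, 0, d) : ℚ) : ℝ) = 1 + (e : ℝ) / (d + 1) := by
    simp only [RatCode.val]
    push_cast
    field_simp
    ring
  simp only [h6]
  rw [abs_lt]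
  constructor <;> linarith [div_pos one_pos hk]

theorem isComputableReal_one : IsComputableReal 1 :=
  ⟨fun _ => (1, 0, 0), Computable.const _, fun k => by simp [RatCode.val]⟩

/-- The rational cuts of `θ` are semidecidable. -/
def HasComputableCuts (θ : ℝ) : Prop :=
  ∃ S T : ℕ × ℕ → ℕ → Bool, Computable₂ S ∧ Computable₂ T ∧
    ∀ a b : ℕ, 0 < a →
      (∀ w, S (a, b) w = true → (b : ℝ) / a ≤ θ) ∧
      ((b : ℝ) / a < θ → ∃ w, S (a, b) w = true) ∧
      (∀ w, T (a, b) w = true → θ ≤ (b : ℝ) / a) ∧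
      (θ < (b : ℝ) / a → ∃ w, T (a, b) w = true)

/-- Inversion reverses order, so the right cut of `1 / p` at `(d + 1) / (d + 1 + e)` serves as the
left cut of `p` at `1 + e / (d + 1)`, and conversely. -/
theorem HasComputableCuts.of_inv {p : ℝ} (hp : 1 < p) (h : HasComputableCuts (1 / p)) :
    IsComputableReal p := by
  obtain ⟨S, T, hS, hT, h⟩ := h
  have hc : Computable fun z : ℕ × ℕ => (z.2 + 1 + z.1, z.2 + 1) :=
    (Primrec.nat_add.to_comp.comp (Computable.succ.comp Computable.snd) Computable.fst).pair
      (Computable.succ.comp Computable.snd)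
  have hq : ∀ e d : ℕ, (((d + 1 : ℕ) : ℝ) / ((d + 1 + e : ℕ) : ℝ)) =
      1 / (1 + (e : ℝ) / (d + 1)) := fun e d => by
    push_cast
    field_simp
  have hq0 : ∀ e d : ℕ, (0 : ℝ) < 1 + (e : ℝ) / (d + 1) := fun e d => by positivity
  have hp0 : 0 < p := by linarith
  refine .of_cuts hp (A := fun z => T (z.2 + 1 + z.1, z.2 + 1))
    (B := fun z => S (z.2 + 1 + z.1, z.2 + 1))
    (hT.comp (hc.comp Computable.fst) Computable.snd).to₂
    (hS.comp (hc.comp Computable.fst) Computable.snd).to₂ ?_ ?_ ?_ ?_ <;>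
  · intro e d
    obtain ⟨h1, h2, h3, h4⟩ := h (d + 1 + e) (d + 1) (by omega)
    simp only [hq, one_div_le_one_div hp0 (hq0 e d),
      one_div_lt_one_div hp0 (hq0 e d), one_div_le_one_div (hq0 e d) hp0,
      one_div_lt_one_div (hq0 e d) hp0] at h1 h2 h3 h4
    assumption

/-- The map `q ↦ 1 - 1 / q` preserves order and sends `1 + e / (d + 1)` to `e / (d + 1 + e)`, so
each cut keeps its side. -/
theorem HasComputableCuts.of_one_sub_inv {p : ℝ} (hp : 1 < p)
    (h : HasComputableCuts (1 - 1 / p)) : IsComputableReal p := by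
  obtain ⟨S, T, hS, hT, h⟩ := h
  have hc : Computable fun z : ℕ × ℕ => (z.2 + 1 + z.1, z.1) :=
    (Primrec.nat_add.to_comp.comp (Computable.succ.comp Computable.snd) Computable.fst).pair
      Computable.fst
  have hq : ∀ e d : ℕ, ((e : ℝ) / ((d + 1 + e : ℕ) : ℝ)) =
      1 - 1 / (1 + (e : ℝ) / (d + 1)) := fun e d => by
    push_cast
    field_simp
    ring
  have hq0 : ∀ e d : ℕ, (0 : ℝ) < 1 + (e : ℝ) / (d + 1) := fun e d => by positivity
  have hp0 : 0 < p := by linarith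
  refine .of_cuts hp (A := fun z => S (z.2 + 1 + z.1, z.1))
    (B := fun z => T (z.2 + 1 + z.1, z.1))
    (hS.comp (hc.comp Computable.fst) Computable.snd).to₂
    (hT.comp (hc.comp Computable.fst) Computable.snd).to₂ ?_ ?_ ?_ ?_ <;>
  · intro e d
    obtain ⟨h1, h2, h3, h4⟩ := h (d + 1 + e) e (by omega)
    simp only [hq, sub_le_sub_iff_left, sub_lt_sub_iff_left, one_div_le_one_div hp0 (hq0 e d),
      one_div_lt_one_div hp0 (hq0 e d), one_div_le_one_div (hq0 e d) hp0,
      one_div_lt_one_div (hq0 e d) hp0] at h1 h2 h3 h4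
    assumption

/-! ### Clarkson's inequalities for scalars. -/

/-- Clarkson's inequality in its scalar form for exponents at most two. -/
theorem norm_add_rpow_add_norm_sub_rpow_le {𝕜 : Type*} [RCLike 𝕜] {p : ℝ} (hp : 1 ≤ p)
    (hp2 : p ≤ 2) (a b : 𝕜) :
    ‖a + b‖ ^ p + ‖a - b‖ ^ p ≤ 2 * (‖a‖ ^ p + ‖b‖ ^ p) := by
  have hp0 : 0 < p := by linarith
  -- The power mean inequality passes from exponent `p` to 2, the parallelogram law evaluates the
  -- quadratic mean, and comparison of the `ℓ²` and `ℓᵖ` norms of `(‖a‖, ‖b‖)` returns to `p`.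
  have h1 : (1 / 2 * ‖a + b‖ ^ p + 1 / 2 * ‖a - b‖ ^ p) ^ (2 / p) ≤
      1 / 2 * (‖a + b‖ ^ p) ^ (2 / p) + 1 / 2 * (‖a - b‖ ^ p) ^ (2 / p) := by
    have := (convexOn_rpow (p := 2 / p) (by rwa [le_div_iff₀ hp0, one_mul])).2
      (Set.mem_Ici.2 (Real.rpow_nonneg (norm_nonneg (a + b)) p))
      (Set.mem_Ici.2 (Real.rpow_nonneg (norm_nonneg (a - b)) p))
      (one_half_pos (α := ℝ)).le (one_half_pos (α := ℝ)).le (add_halves 1)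
    simpa only [smul_eq_mul] using this
  have hpow : ∀ t : ℝ, 0 ≤ t → (t ^ p) ^ (2 / p) = t ^ 2 := fun t ht => by
    rw [← Real.rpow_mul ht, mul_div_cancel₀ _ hp0.ne', Real.rpow_two]
  rw [hpow _ (norm_nonneg _), hpow _ (norm_nonneg _)] at h1
  have h2 : ‖a + b‖ ^ 2 + ‖a - b‖ ^ 2 = 2 * (‖a‖ ^ 2 + ‖b‖ ^ 2) := by
    simpa only [sq] using parallelogram_law_with_norm 𝕜 a b
  have h3 := Real.rpow_add_rpow_le (norm_nonneg a) (norm_nonneg b) hp0 hp2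
  have h4 : ‖a‖ ^ 2 + ‖b‖ ^ 2 ≤ (‖a‖ ^ p + ‖b‖ ^ p) ^ (2 / p) := by
    have := Real.rpow_le_rpow (by positivity) h3 (zero_le_two (α := ℝ))
    rw [← Real.rpow_mul (by positivity), ← Real.rpow_mul (by positivity)] at this
    simpa [div_eq_inv_mul] using this
  have h5 := (Real.rpow_le_rpow_iff (by positivity) (by positivity)
    (by positivity : 0 < 2 / p)).1 ((h1.trans (by linarith)).trans h4)
  linarith

/-- Clarkson's inequality in its scalar form for exponents at least two. -/
theorem two_mul_norm_rpow_add_norm_rpow_le {𝕜 : Type*} [RCLike 𝕜] {p : ℝ} (hp : 2 ≤ p)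
    (a b : 𝕜) :
    2 * (‖a‖ ^ p + ‖b‖ ^ p) ≤ ‖a + b‖ ^ p + ‖a - b‖ ^ p := by
  have hp0 : 0 < p := by linarith
  have h1 : (1 / 2 * ‖a + b‖ ^ 2 + 1 / 2 * ‖a - b‖ ^ 2) ^ (p / 2) ≤
      1 / 2 * (‖a + b‖ ^ 2) ^ (p / 2) + 1 / 2 * (‖a - b‖ ^ 2) ^ (p / 2) := by
    have := (convexOn_rpow (p := p / 2) (by linarith)).2
      (Set.mem_Ici.2 (sq_nonneg ‖a + b‖)) (Set.mem_Ici.2 (sq_nonneg ‖a - b‖))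
      (one_half_pos (α := ℝ)).le (one_half_pos (α := ℝ)).le (add_halves 1)
    simpa only [smul_eq_mul] using this
  have hpow : ∀ t : ℝ, 0 ≤ t → (t ^ 2) ^ (p / 2) = t ^ p := fun t ht => by
    rw [← Real.rpow_two, ← Real.rpow_mul ht, mul_div_cancel₀ _ two_ne_zero]
  rw [hpow _ (norm_nonneg _), hpow _ (norm_nonneg _)] at h1
  have h2 : ‖a + b‖ ^ 2 + ‖a - b‖ ^ 2 = 2 * (‖a‖ ^ 2 + ‖b‖ ^ 2) := by
    simpa only [sq] using parallelogram_law_with_norm 𝕜 a b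
  have h3 := Real.rpow_add_rpow_le (norm_nonneg a) (norm_nonneg b) two_pos hp
  have h4 : ‖a‖ ^ p + ‖b‖ ^ p ≤ (‖a‖ ^ 2 + ‖b‖ ^ 2) ^ (p / 2) := by
    have := Real.rpow_le_rpow (by positivity) h3 hp0.le
    rw [← Real.rpow_mul (by positivity), ← Real.rpow_mul (by positivity)] at this
    simpa [div_eq_inv_mul, hp0.ne'] using this
  have h5 : ‖a‖ ^ 2 + ‖b‖ ^ 2 = 1 / 2 * ‖a + b‖ ^ 2 + 1 / 2 * ‖a - b‖ ^ 2 := by linarith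
  rw [h5] at h4
  linarith

/-! ### The James constant of `ℓ^p_n`. -/

/-- `2 ^ θ` is the James constant of `V`, and it is attained. -/
def HasJamesExponent (V : Type*) [NormedAddCommGroup V] (θ : ℝ) : Prop :=
  (∀ x y : V, min ‖x + y‖ ‖x - y‖ ≤ 2 ^ θ * max ‖x‖ ‖y‖) ∧
    ∃ x y : V, ‖x‖ ≤ 1 ∧ ‖y‖ ≤ 1 ∧ 2 ^ θ ≤ ‖x + y‖ ∧ 2 ^ θ ≤ ‖x - y‖

section FiniteEllp

variable {𝕜 : Type*} [RCLike 𝕜] {p : ℝ} {n : ℕ}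

theorem FiniteEllp.norm_rpow [hp : Fact (1 ≤ p)] (x : FiniteEllp 𝕜 p n) :
    ‖x‖ ^ p = ∑ i, ‖x i‖ ^ p := by
  have hp0 : 0 < p := by linarith [hp.out]
  have h : (ENNReal.ofReal p).toReal = p := ENNReal.toReal_ofReal hp0.le
  rw [PiLp.norm_eq_sum (by rwa [h]), h, ← Real.rpow_mul (Finset.sum_nonneg fun i _ => by positivity),
    one_div_mul_cancel hp0.ne', Real.rpow_one]

theorem FiniteEllp.norm_add_rpow_add_norm_sub_rpow_le [hp : Fact (1 ≤ p)] (hp2 : p ≤ 2)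
    (x y : FiniteEllp 𝕜 p n) :
    ‖x + y‖ ^ p + ‖x - y‖ ^ p ≤ 2 * (‖x‖ ^ p + ‖y‖ ^ p) := by
  simp only [norm_rpow, ← Finset.sum_add_distrib, Finset.mul_sum]
  exact Finset.sum_le_sum fun i _ => _root_.norm_add_rpow_add_norm_sub_rpow_le hp.out hp2 (x i) (y i)

theorem FiniteEllp.two_mul_norm_rpow_add_norm_rpow_le [hp : Fact (1 ≤ p)] (hp2 : 2 ≤ p)
    (x y : FiniteEllp 𝕜 p n) :
    2 * (‖x‖ ^ p + ‖y‖ ^ p) ≤ ‖x + y‖ ^ p + ‖x - y‖ ^ p := by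
  simp only [norm_rpow, ← Finset.sum_add_distrib, Finset.mul_sum]
  exact Finset.sum_le_sum fun i _ => _root_.two_mul_norm_rpow_add_norm_rpow_le hp2 (x i) (y i)

/-- The vector with entries `a`, `b` in its first two coordinates. -/
noncomputable def FiniteEllp.pair (hn : 2 ≤ n) (a b : 𝕜) : FiniteEllp 𝕜 p n :=
  WithLp.toLp _ (Pi.single ⟨0, by omega⟩ a + Pi.single ⟨1, by omega⟩ b)

theorem FiniteEllp.norm_pair_rpow [hp : Fact (1 ≤ p)] (hn : 2 ≤ n) (a b : 𝕜) :
    ‖(FiniteEllp.pair hn a b : FiniteEllp 𝕜 p n)‖ ^ p = ‖a‖ ^ p + ‖b‖ ^ p := by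
  have hp0 : p ≠ 0 := by linarith [hp.out]
  have h01 : (⟨0, by omega⟩ : Fin n) ≠ ⟨1, by omega⟩ := by simp
  rw [norm_rpow, Finset.sum_eq_add_of_mem _ _ (Finset.mem_univ _) (Finset.mem_univ _) h01]
  · simp [pair, h01, h01.symm]
  · rintro c - ⟨h0, h1⟩
    simp [pair, h0, h1, hp0]

theorem FiniteEllp.pair_add (hn : 2 ≤ n) (a b c d : 𝕜) :
    (pair hn a b + pair hn c d : FiniteEllp 𝕜 p n) = pair hn (a + c) (b + d) := by
  simp only [pair, ← WithLp.toLp_add, Pi.single_add]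
  congr 1
  abel

theorem FiniteEllp.pair_sub (hn : 2 ≤ n) (a b c d : 𝕜) :
    (pair hn a b - pair hn c d : FiniteEllp 𝕜 p n) = pair hn (a - c) (b - d) := by
  simp only [pair, ← WithLp.toLp_sub, Pi.single_sub]
  congr 1
  abel

theorem le_of_rpow_le {p s t : ℝ} (hp : 0 < p) (hs : 0 ≤ s) (ht : 0 ≤ t) (h : s ^ p ≤ t ^ p) :
    s ≤ t :=
  (Real.rpow_le_rpow_iff hs ht hp).1 h

/-- The `p`-th power of the minimum is at most the average of those of `‖x + y‖` and `‖x - y‖`,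
which Clarkson bounds by `‖x‖ ^ p + ‖y‖ ^ p`. Two standard basis vectors give equality. -/
theorem FiniteEllp.hasJamesExponent_of_le_two [hp : Fact (1 ≤ p)] (hn : 2 ≤ n) (hp2 : p ≤ 2) :
    HasJamesExponent (FiniteEllp 𝕜 p n) (1 / p) := by
  have hp0 : 0 < p := by linarith [hp.out]
  have h2 : ((2 : ℝ) ^ (1 / p)) ^ p = 2 := by
    rw [← Real.rpow_mul zero_le_two, one_div_mul_cancel hp0.ne', Real.rpow_one]
  refine ⟨fun x y => le_of_rpow_le hp0 (by positivity) (by positivity) ?_,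
    pair hn 1 0, pair hn 0 1, ?_⟩
  · rw [Real.mul_rpow (by positivity) (by positivity), h2]
    have h := norm_add_rpow_add_norm_sub_rpow_le hp2 x y
    have h3 : min ‖x + y‖ ‖x - y‖ ^ p ≤ ‖x + y‖ ^ p :=
      Real.rpow_le_rpow (by positivity) (min_le_left _ _) hp0.le
    have h4 : min ‖x + y‖ ‖x - y‖ ^ p ≤ ‖x - y‖ ^ p :=
      Real.rpow_le_rpow (by positivity) (min_le_right _ _) hp0.le
    have h5 : ‖x‖ ^ p ≤ max ‖x‖ ‖y‖ ^ p :=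
      Real.rpow_le_rpow (by positivity) (le_max_left _ _) hp0.le
    have h6 : ‖y‖ ^ p ≤ max ‖x‖ ‖y‖ ^ p :=
      Real.rpow_le_rpow (by positivity) (le_max_right _ _) hp0.le
    linarith
  · refine ⟨le_of_rpow_le hp0 (norm_nonneg _) zero_le_one ?_,
      le_of_rpow_le hp0 (norm_nonneg _) zero_le_one ?_,
      le_of_rpow_le hp0 (by positivity) (norm_nonneg _) ?_,
      le_of_rpow_le hp0 (by positivity) (norm_nonneg _) ?_⟩ <;>
    simp only [pair_add, pair_sub, norm_pair_rpow, h2] <;> norm_num [hp0.ne']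

/-- Clarkson's inequality for `2 ≤ p` bounds `‖x ± y‖` from below; applied to `x + y` and `x - y`,
whose sum and difference are `2x` and `2y`, it gives the upper bound. Equality holds at the
normalized vectors `(1, 1)` and `(1, -1)`. -/
theorem FiniteEllp.hasJamesExponent_of_two_le [hp : Fact (1 ≤ p)] (hn : 2 ≤ n) (hp2 : 2 ≤ p) :
    HasJamesExponent (FiniteEllp 𝕜 p n) (1 - 1 / p) := by
  have hp0 : 0 < p := by linarith [hp.out]
  have h2 : ((2 : ℝ) ^ (1 - 1 / p)) ^ p = 2 ^ p / 2 := by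
    rw [← Real.rpow_mul zero_le_two, sub_mul, one_div_mul_cancel hp0.ne', one_mul,
      Real.rpow_sub two_pos, Real.rpow_one]
  refine ⟨fun x y => le_of_rpow_le hp0 (by positivity) (by positivity) ?_, ?_⟩
  · rw [Real.mul_rpow (by positivity) (by positivity), h2]
    have h := two_mul_norm_rpow_add_norm_rpow_le hp2 (x + y) (x - y)
    have e1 : x + y + (x - y) = (2 : 𝕜) • x := by rw [two_smul]; abel
    have e2 : x + y - (x - y) = (2 : 𝕜) • y := by rw [two_smul]; abel
    rw [e1, e2, norm_smul, norm_smul, RCLike.norm_ofNat,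
      Real.mul_rpow zero_le_two (norm_nonneg _), Real.mul_rpow zero_le_two (norm_nonneg _)] at h
    have h3 : min ‖x + y‖ ‖x - y‖ ^ p ≤ ‖x + y‖ ^ p :=
      Real.rpow_le_rpow (by positivity) (min_le_left _ _) hp0.le
    have h4 : min ‖x + y‖ ‖x - y‖ ^ p ≤ ‖x - y‖ ^ p :=
      Real.rpow_le_rpow (by positivity) (min_le_right _ _) hp0.le
    have h5 : ‖x‖ ^ p ≤ max ‖x‖ ‖y‖ ^ p :=
      Real.rpow_le_rpow (by positivity) (le_max_left _ _) hp0.le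
    have h6 : ‖y‖ ^ p ≤ max ‖x‖ ‖y‖ ^ p :=
      Real.rpow_le_rpow (by positivity) (le_max_right _ _) hp0.le
    have h7 := mul_le_mul_of_nonneg_left (add_le_add h5 h6)
      (Real.rpow_nonneg (zero_le_two (α := ℝ)) p)
    linarith
  · let c : ℝ := (1 / 2) ^ (1 / p)
    have hc : c ^ p = 1 / 2 := by
      rw [← Real.rpow_mul (by norm_num), one_div_mul_cancel hp0.ne', Real.rpow_one]
    have hc0 : 0 ≤ c := by positivity
    have hc' : ‖(c : 𝕜)‖ ^ p = 1 / 2 := by rw [RCLike.norm_ofReal, abs_of_nonneg hc0, hc]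
    have hcc : ‖(c : 𝕜) + c‖ ^ p = 2 ^ p / 2 := by
      rw [← two_mul, norm_mul, RCLike.norm_ofNat, Real.mul_rpow zero_le_two (norm_nonneg _), hc']
      ring
    refine ⟨pair hn c c, pair hn c (-c), le_of_rpow_le hp0 (norm_nonneg _) zero_le_one ?_,
      le_of_rpow_le hp0 (norm_nonneg _) zero_le_one ?_,
      le_of_rpow_le hp0 (by positivity) (norm_nonneg _) ?_,
      le_of_rpow_le hp0 (by positivity) (norm_nonneg _) ?_⟩ <;>
    simp only [pair_add, pair_sub, norm_pair_rpow, h2, norm_neg, hc', hcc, sub_self, add_neg_cancel,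
      sub_neg_eq_add] <;> norm_num [hp0.ne']

end FiniteEllp

/-! ### Semidecidable cuts from approximate norms on a net. -/

theorem two_rpow_div_pow {a b : ℕ} (ha : 0 < a) : ((2 : ℝ) ^ ((b : ℝ) / a)) ^ a = 2 ^ b := by
  have ha' : (a : ℝ) ≠ 0 := by exact_mod_cast ha.ne'
  rw [← Real.rpow_natCast, ← Real.rpow_mul zero_le_two, div_mul_cancel₀ _ ha', Real.rpow_natCast]

theorem div_lt_of_two_rpow_mul_lt {a b : ℕ} (ha : 0 < a) {θ u v : ℝ} (hu : 0 ≤ u) (hv : 0 ≤ v)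
    (h : 2 ^ b * u ^ a < v ^ a) (huv : v ≤ 2 ^ θ * u) : (b : ℝ) / a < θ := by
  rw [← two_rpow_div_pow ha, ← mul_pow] at h
  have h1 := (lt_of_pow_lt_pow_left₀ a hv h).trans_le huv
  exact (Real.rpow_lt_rpow_left_iff one_lt_two).1 (lt_of_mul_lt_mul_right h1 hu)

theorem le_div_of_pow_le_two_pow_mul {a b : ℕ} (ha : 0 < a) {θ u v : ℝ} (hu : 0 < u)
    (h : v ^ a ≤ 2 ^ b * u ^ a) (huv : 2 ^ θ * u ≤ v) : θ ≤ (b : ℝ) / a := by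
  rw [← two_rpow_div_pow ha, ← mul_pow] at h
  have h1 := huv.trans (le_of_pow_le_pow_left₀ ha.ne' (by positivity) h)
  exact (Real.rpow_le_rpow_left_iff one_lt_two).1 (le_of_mul_le_mul_right h1 hu)

/-- If the norms of `X z`, `Y z`, `X z + Y z`, `X z - Y z` are uniformly computable up to a
bounded error and the pairs `(X z, Y z)` form an effective net on large balls, then the James
exponent of the space has semidecidable cuts. -/
theorem HasJamesExponent.hasComputableCuts {𝕜 V : Type*} [RCLike 𝕜] [NormedAddCommGroup V]
    [NormedSpace 𝕜 V] {θ : ℝ} (hJ : HasJamesExponent V θ) {X Y : ℕ × ℕ → V} {gx gy gp gm : ℕ × ℕ → ℕ}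
    (hgx : Computable gx) (hgy : Computable gy) (hgp : Computable gp) (hgm : Computable gm)
    (hX : ∀ z, |(gx z : ℝ) - ‖X z‖| ≤ 2) (hY : ∀ z, |(gy z : ℝ) - ‖Y z‖| ≤ 2)
    (hP : ∀ z, |(gp z : ℝ) - ‖X z + Y z‖| ≤ 2) (hM : ∀ z, |(gm z : ℝ) - ‖X z - Y z‖| ≤ 2)
    (R D c : ℕ) (hnet : ∀ (M : ℕ) (x y : V), ‖x‖ ≤ 1 → ‖y‖ ≤ 1 →
      ∃ i < (2 * (R * M) + 1) ^ c, ‖X (R * M, i) - (M : 𝕜) • x‖ ≤ D ∧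
        ‖Y (R * M, i) - (M : 𝕜) • y‖ ≤ D) :
    HasComputableCuts θ := by
  obtain ⟨hJ, x₀, y₀, hx₀, hy₀, hp₀, hm₀⟩ := hJ
  -- Net points near the scaled extremal pair: each vector is off by at most `D`, so sums and
  -- differences by `2 * D`, and each computed norm by 2 more.
  have hnet₀ : ∀ M : ℕ, ∃ i < (2 * (R * M) + 1) ^ c,
      (gx (R * M, i) : ℝ) ≤ M + D + 2 ∧ (gy (R * M, i) : ℝ) ≤ M + D + 2 ∧
      (2 : ℝ) ^ θ * M - 2 * D - 2 ≤ gp (R * M, i) ∧ (2 : ℝ) ^ θ * M - 2 * D - 2 ≤ gm (R * M, i) := by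
    intro M
    obtain ⟨i, hi, h1, h2⟩ := hnet M x₀ y₀ hx₀ hy₀
    have hn : ∀ v : V, ‖(M : 𝕜) • v‖ = M * ‖v‖ := fun v => by simp [norm_smul]
    have hM0 : (0 : ℝ) ≤ M := Nat.cast_nonneg M
    refine ⟨i, hi, ?_⟩
    generalize (R * M, i) = z at h1 h2 ⊢
    have a1 := abs_le.1 (hX z)
    have a2 := abs_le.1 (hY z)
    have a3 := abs_le.1 (hP z)
    have a4 := abs_le.1 (hM z)
    have b1 := norm_sub_norm_le (X z) ((M : 𝕜) • x₀)
    have b2 := norm_sub_norm_le (Y z) ((M : 𝕜) • y₀)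
    have b3 : ‖(M : 𝕜) • (x₀ + y₀)‖ ≤ ‖X z + Y z‖ +
        (‖X z - (M : 𝕜) • x₀‖ + ‖Y z - (M : 𝕜) • y₀‖) := by
      have e : (M : 𝕜) • (x₀ + y₀) =
          (X z + Y z) - ((X z - (M : 𝕜) • x₀) + (Y z - (M : 𝕜) • y₀)) := by
        rw [smul_add]; abel
      rw [e]
      exact (norm_sub_le _ _).trans (add_le_add_right (norm_add_le _ _) _)
    have b4 : ‖(M : 𝕜) • (x₀ - y₀)‖ ≤ ‖X z - Y z‖ +
        (‖X z - (M : 𝕜) • x₀‖ + ‖Y z - (M : 𝕜) • y₀‖) := by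
      have e : (M : 𝕜) • (x₀ - y₀) =
          (X z - Y z) - ((X z - (M : 𝕜) • x₀) - (Y z - (M : 𝕜) • y₀)) := by
        rw [smul_sub]; abel
      rw [e]
      exact (norm_sub_le _ _).trans (add_le_add_right (norm_sub_le _ _) _)
    rw [hn] at b1 b2 b3 b4
    have c1 := mul_le_mul_of_nonneg_left hx₀ hM0
    have c2 := mul_le_mul_of_nonneg_left hy₀ hM0
    have c3 := mul_le_mul_of_nonneg_left hp₀ hM0
    have c4 := mul_le_mul_of_nonneg_left hm₀ hM0
    exact ⟨by linarith, by linarith, by linarith, by linarith⟩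
  let E := 2 * D + 2
  -- A lower-bound certificate is one pair, not necessarily from the net of a particular ball; the
  -- margins 2 absorb the norm errors.
  let S : ℕ × ℕ → ℕ → Bool := fun q w =>
    decide (2 ^ q.2 * (max (gx w.unpair) (gy w.unpair) + 2) ^ q.1 <
      (min (gp w.unpair) (gm w.unpair) - 2) ^ q.1)
  -- Upper-bound test at radius `w + 1`, which is positive as the division by it requires: each net
  -- pair is visibly outside the enlarged ball or obeys the bound with margin `E`.
  let t : (ℕ × ℕ) × ℕ → ℕ → Bool := fun z i =>
    decide (z.2 + 1 + E < max (gx (R * (z.2 + 1), i)) (gy (R * (z.2 + 1), i))) ||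
      decide ((min (gp (R * (z.2 + 1), i)) (gm (R * (z.2 + 1), i)) + E) ^ z.1.1 ≤
        2 ^ z.1.2 * (z.2 + 1) ^ z.1.1)
  let T : ℕ × ℕ → ℕ → Bool := fun q w =>
    decide (∀ i < (2 * (R * (w + 1)) + 1) ^ c, t (q, w) i = true)
  have hadd : ∀ {α : Type} [Primcodable α] {f g : α → ℕ}, Computable f → Computable g →
      Computable fun a => f a + g a := fun hf hg => Primrec.nat_add.to_comp.comp hf hg
  have hsub : ∀ {α : Type} [Primcodable α] {f g : α → ℕ}, Computable f → Computable g →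
      Computable fun a => f a - g a := fun hf hg => Primrec.nat_sub.to_comp.comp hf hg
  have hmul : ∀ {α : Type} [Primcodable α] {f g : α → ℕ}, Computable f → Computable g →
      Computable fun a => f a * g a := fun hf hg => Primrec.nat_mul.to_comp.comp hf hg
  have hmax : ∀ {α : Type} [Primcodable α] {f g : α → ℕ}, Computable f → Computable g →
      Computable fun a => max (f a) (g a) := fun hf hg => Primrec.nat_max.to_comp.comp hf hg
  have hmin : ∀ {α : Type} [Primcodable α] {f g : α → ℕ}, Computable f → Computable g →
      Computable fun a => min (f a) (g a) := fun hf hg => Primrec.nat_min.to_comp.comp hf hg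
  have hS : Computable₂ S := by
    have a : Computable fun z : (ℕ × ℕ) × ℕ => z.1.1 := Computable.fst.comp Computable.fst
    have b : Computable fun z : (ℕ × ℕ) × ℕ => z.1.2 := Computable.snd.comp Computable.fst
    have w : Computable fun z : (ℕ × ℕ) × ℕ => z.2.unpair :=
      Computable.unpair.comp Computable.snd
    exact computable_decide_lt
      (hmul (.nat_pow (Computable.const 2) b) (.nat_pow
        (hadd (hmax (hgx.comp w) (hgy.comp w)) (Computable.const 2)) a))
      (.nat_pow (hsub (hmin (hgp.comp w) (hgm.comp w)) (Computable.const 2)) a)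
  have ht : Computable₂ t := by
    have a : Computable fun z : ((ℕ × ℕ) × ℕ) × ℕ => z.1.1.1 :=
      Computable.fst.comp (Computable.fst.comp Computable.fst)
    have b : Computable fun z : ((ℕ × ℕ) × ℕ) × ℕ => z.1.1.2 :=
      Computable.snd.comp (Computable.fst.comp Computable.fst)
    have m : Computable fun z : ((ℕ × ℕ) × ℕ) × ℕ => z.1.2 + 1 :=
      Computable.succ.comp (Computable.snd.comp Computable.fst)
    have w : Computable fun z : ((ℕ × ℕ) × ℕ) × ℕ => (R * (z.1.2 + 1), z.2) :=
      (hmul (Computable.const R) m).pair Computable.snd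
    exact Primrec.or.to_comp.comp
      (computable_decide_lt (hadd m (Computable.const E)) (hmax (hgx.comp w) (hgy.comp w)))
      (computable_decide_le
        (.nat_pow (hadd (hmin (hgp.comp w) (hgm.comp w)) (Computable.const E)) a)
        (hmul (.nat_pow (Computable.const 2) b) (.nat_pow m a)))
  have hT : Computable₂ T := by
    have m : Computable fun z : (ℕ × ℕ) × ℕ => z.2 + 1 := Computable.succ.comp Computable.snd
    exact computable_forall_lt (.nat_pow (hadd (hmul (Computable.const 2)
      (hmul (Computable.const R) m)) (Computable.const 1)) (Computable.const c)) ht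
  refine ⟨S, T, hS, hT, fun a b ha => ⟨fun w hw => ?_, fun hlt => ?_, fun w hw => ?_,
    fun hlt => ?_⟩⟩
  · simp only [S, decide_eq_true_eq] at hw
    generalize w.unpair = z at hw
    -- If the truncated subtraction vanished, so would its power, because `0 < a`; hence it agrees
    -- with real subtraction.
    have h2 : 2 ≤ min (gp z) (gm z) := by
      by_contra! h
      rw [Nat.sub_eq_zero_of_le h.le, zero_pow ha.ne'] at hw
      exact absurd hw (Nat.not_lt_zero _)
    have hw' : (2 : ℝ) ^ b * ((max (gx z) (gy z) : ℝ) + 2) ^ a <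
        ((min (gp z) (gm z) : ℝ) - 2) ^ a := by
      have := (Nat.cast_lt (α := ℝ)).2 hw
      push_cast [h2] at this
      exact this
    have h2' : (2 : ℝ) ≤ min (gp z : ℝ) (gm z) := by exact_mod_cast h2
    refine (div_lt_of_two_rpow_mul_lt ha (by positivity) (by linarith) hw' ?_).le
    have a1 := abs_le.1 (hX z)
    have a2 := abs_le.1 (hY z)
    have a3 := abs_le.1 (hP z)
    have a4 := abs_le.1 (hM z)
    refine le_trans ?_ ((hJ (X z) (Y z)).trans (mul_le_mul_of_nonneg_left ?_ (by positivity)))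
    · refine le_min ?_ ?_
      · linarith [min_le_left (gp z : ℝ) (gm z)]
      · linarith [min_le_right (gp z : ℝ) (gm z)]
    · refine max_le ?_ ?_
      · linarith [le_max_left (gx z : ℝ) (gy z)]
      · linarith [le_max_right (gx z : ℝ) (gy z)]
  · have hJs := sub_pos.2 ((Real.rpow_lt_rpow_left_iff one_lt_two).2 hlt)
    obtain ⟨M, hM'⟩ := exists_nat_gt
      (((2 : ℝ) ^ ((b : ℝ) / a) * (D + 4) + (2 * D + 4)) / (2 ^ θ - 2 ^ ((b : ℝ) / a)))
    rw [div_lt_iff₀ hJs] at hM'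
    obtain ⟨i, -, h1, h2, h3, h4⟩ := hnet₀ M
    refine ⟨Nat.pair (R * M) i, ?_⟩
    simp only [S, decide_eq_true_eq, Nat.unpair_pair]
    generalize (R * M, i) = z at h1 h2 h3 h4 ⊢
    have h5 : (2 : ℝ) ^ ((b : ℝ) / a) * ((max (gx z) (gy z) : ℝ) + 2) <
        (min (gp z : ℝ) (gm z)) - 2 := by
      have h6 : (max (gx z) (gy z) : ℝ) + 2 ≤ M + D + 4 := by linarith [max_le h1 h2]
      have h7 := le_min h3 h4
      have h8 := mul_le_mul_of_nonneg_left h6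
        (Real.rpow_nonneg (zero_le_two (α := ℝ)) ((b : ℝ) / a))
      linarith
    have h6 : 2 ≤ min (gp z) (gm z) := by
      have h0 : (0 : ℝ) ≤ 2 ^ ((b : ℝ) / a) * ((max (gx z) (gy z) : ℝ) + 2) := by positivity
      have : (2 : ℝ) ≤ min (gp z : ℝ) (gm z) := by linarith
      exact_mod_cast this
    rw [← Nat.cast_lt (α := ℝ)]
    push_cast [h6]
    have h7 := pow_lt_pow_left₀ h5 (by positivity) ha.ne'
    rwa [mul_pow, two_rpow_div_pow ha] at h7
  -- The net pair near the scaled extremal pair stays in the enlarged ball, so it must pass the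
  -- second test, which then bounds `2 ^ θ`.
  · obtain ⟨i, hi, h1, h2, h3, h4⟩ := hnet₀ (w + 1)
    simp only [T, decide_eq_true_eq] at hw
    replace hw := hw i hi
    simp only [t, Bool.or_eq_true, decide_eq_true_eq] at hw
    generalize (R * (w + 1), i) = z at h1 h2 h3 h4 hw
    push_cast at h1 h2 h3 h4
    have hD : (0 : ℝ) ≤ D := Nat.cast_nonneg D
    have hE : (E : ℝ) = 2 * D + 2 := by simp [E]
    rcases hw with hw | hw
    · have := (Nat.cast_lt (α := ℝ)).2 hw
      push_cast at this
      linarith [max_le h1 h2]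
    · have := (Nat.cast_le (α := ℝ)).2 hw
      push_cast at this
      exact le_div_of_pow_le_two_pow_mul ha (by positivity) this (by linarith [le_min h3 h4])
  · have hJs := sub_pos.2 ((Real.rpow_lt_rpow_left_iff one_lt_two).2 hlt)
    -- At this radius the gap between `2 ^ θ` and `2 ^ (b / a)` outweighs all fixed errors, so every
    -- pair in the enlarged ball passes.
    obtain ⟨M, hM'⟩ := exists_nat_gt
      (((2 : ℝ) ^ θ * (E + 2) + 2 + E) / (2 ^ ((b : ℝ) / a) - 2 ^ θ))
    rw [div_lt_iff₀ hJs] at hM'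
    refine ⟨M, ?_⟩
    simp only [T, decide_eq_true_eq]
    intro i _
    simp only [t, Bool.or_eq_true, decide_eq_true_eq]
    generalize (R * (M + 1), i) = z
    refine or_iff_not_imp_left.2 fun hz => ?_
    have hz' : (max (gx z) (gy z) : ℝ) ≤ M + 1 + E := by exact_mod_cast not_lt.1 hz
    have a1 := abs_le.1 (hX z)
    have a2 := abs_le.1 (hY z)
    have a3 := abs_le.1 (hP z)
    have a4 := abs_le.1 (hM z)
    have h5 : max ‖X z‖ ‖Y z‖ ≤ M + 1 + E + 2 := by
      refine max_le ?_ ?_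
      · linarith [le_max_left (gx z : ℝ) (gy z)]
      · linarith [le_max_right (gx z : ℝ) (gy z)]
    have h6 : min (gp z : ℝ) (gm z) ≤ min ‖X z + Y z‖ ‖X z - Y z‖ + 2 := by
      rw [← min_add_add_right]
      exact min_le_min (by linarith) (by linarith)
    have h7 := (hJ (X z) (Y z)).trans
      (mul_le_mul_of_nonneg_left h5 (Real.rpow_nonneg (zero_le_two (α := ℝ)) θ))
    have h8 : min (gp z : ℝ) (gm z) + E ≤ 2 ^ ((b : ℝ) / a) * (M + 1) := by linarith
    have h9 := pow_le_pow_left₀ (by positivity) h8 a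
    rw [mul_pow, two_rpow_div_pow ha] at h9
    exact_mod_cast h9

/-! ### Rounded norms and an effective lattice net. -/

theorem BanachPresentation.ratVec_map_range {𝕜 : Type*} [RCLike 𝕜] {B : Type*}
    [NormedAddCommGroup B] [NormedSpace 𝕜 B] [CompleteSpace B] (P : BanachPresentation 𝕜 B)
    (L : ℕ) (h : ℕ → ScalarCode) :
    P.ratVec ((List.range L).map h) = ∑ j : Fin L, (h j).val 𝕜 • P.vec j := by
  rw [BanachPresentation.ratVec]
  refine Fintype.sum_equiv (finCongr (by simp)) _ _ fun j => ?_
  simp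

/-- The natural number part of a coded rational number. -/
def RatCode.natPart (c : RatCode) : ℕ := (c.1 - c.2.1) / (c.2.2 + 1)

theorem RatCode.computable_natPart : Computable RatCode.natPart :=
  (Primrec.nat_div.comp
    (Primrec.nat_sub.comp Primrec.fst (Primrec.fst.comp Primrec.snd))
    (Primrec.succ.comp (Primrec.snd.comp Primrec.snd))).to_comp

/-- Rounding down adds an error below 1 to the given one, and truncating negative values at zero is
harmless since `0 ≤ x`. -/
theorem RatCode.abs_natPart_sub_le {c : RatCode} {x : ℝ} (hx : 0 ≤ x)
    (h : |(c.val : ℝ) - x| < 1) : |(c.natPart : ℝ) - x| ≤ 2 := by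
  obtain ⟨a, b, d⟩ := c
  rw [abs_lt] at h
  rw [abs_le]
  have hd : (0 : ℝ) < d + 1 := by positivity
  simp only [RatCode.val, RatCode.natPart] at h ⊢
  push_cast at h
  rcases le_total a b with hab | hab
  · have : ((a : ℝ) - b) / (d + 1) ≤ 0 :=
      div_nonpos_of_nonpos_of_nonneg (sub_nonpos.2 (by exact_mod_cast hab)) hd.le
    rw [Nat.sub_eq_zero_of_le hab, Nat.zero_div, Nat.cast_zero]
    constructor <;> linarith
  · have h1 : (((a - b) / (d + 1) : ℕ) : ℝ) ≤ ((a : ℝ) - b) / (d + 1) := by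
      have := Nat.cast_div_le (α := ℝ) (m := a - b) (n := d + 1)
      push_cast [hab] at this
      exact this
    have h2 : ((a : ℝ) - b) / (d + 1) < (((a - b) / (d + 1) : ℕ) : ℝ) + 1 := by
      rw [div_lt_iff₀ hd]
      have := Nat.lt_mul_div_succ (a - b) (Nat.succ_pos d)
      have := (Nat.cast_lt (α := ℝ)).2 this
      push_cast [hab] at this
      linarith
    constructor <;> linarith

/-- The `j`-th digit of `i` in base `m`. -/
def baseDigit (m i j : ℕ) : ℕ := i / m ^ j % m

theorem exists_baseDigit_eq {m n : ℕ} (s : Fin n → ℕ) (hs : ∀ j, s j < m) :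
    ∃ i < m ^ n, ∀ j : Fin n, baseDigit m i j = s j := by
  let i := finFunctionFinEquiv (fun j : Fin n => (⟨s j, hs j⟩ : Fin m))
  refine ⟨i, i.2, fun j => ?_⟩
  have h := congrFun (finFunctionFinEquiv.symm_apply_apply
    (fun j : Fin n => (⟨s j, hs j⟩ : Fin m))) j
  exact congrArg Fin.val h

section lattice

variable {𝕜 : Type*} [RCLike 𝕜] {V : Type*} [NormedAddCommGroup V] [NormedSpace 𝕜 V]

/-- Subspaces of a finite-dimensional space are closed, so a dense span is everything, and finitely
many of the vectors already generate it. -/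
theorem exists_span_range_fin_eq_top [FiniteDimensional 𝕜 V] {v : ℕ → V}
    (hv : (Submodule.span 𝕜 (Set.range v)).topologicalClosure = ⊤) :
    ∃ L : ℕ, Submodule.span 𝕜 (Set.range fun j : Fin L => v j) = ⊤ := by
  have htop : Submodule.span 𝕜 (Set.range v) = ⊤ := by
    rw [← hv]
    exact ((Submodule.closed_of_finiteDimensional _).submodule_topologicalClosure_eq).symm
  obtain ⟨s, hs, hspan⟩ := (Submodule.fg_span_iff_fg_span_finset_subset (R := 𝕜)
    (Set.range v)).1 (htop ▸ Module.Finite.fg_top)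
  choose! f hf using fun x (hx : x ∈ (s : Set V)) => hs hx
  refine ⟨s.sup f + 1, top_unique ?_⟩
  rw [← htop, hspan]
  refine Submodule.span_mono fun x hx => ?_
  exact ⟨⟨f x, Nat.lt_succ_of_le (Finset.le_sup (f := f) hx)⟩, hf x hx⟩

/-- The Gaussian integer with real part `a - b` and imaginary part `c - d`. -/
def gaussCode (a b c d : ℕ) : ScalarCode := ((a, b, 0), (c, d, 0))

theorem val_gaussCode (a b c d : ℕ) :
    (gaussCode a b c d).val 𝕜 = ((a : 𝕜) - b) + ((c : 𝕜) - d) * RCLike.I := by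
  simp [gaussCode, ScalarCode.val, RatCode.val]

/-- Real and imaginary parts are rounded down separately, after a shift by `K` that makes them
nonnegative. Over `ℝ` the second part is multiplied by `RCLike.I = 0`. -/
theorem exists_gauss_near (K : ℕ) (z : 𝕜) (hz : ‖z‖ ≤ K) :
    ∃ a < 2 * K + 1, ∃ b < 2 * K + 1, ‖((a : 𝕜) - K) + ((b : 𝕜) - K) * RCLike.I - z‖ ≤ 2 := by
  have key : ∀ t : ℝ, |t| ≤ K → ∃ a < 2 * K + 1, |(a : ℝ) - K - t| ≤ 1 := fun t ht => by
    rw [abs_le] at ht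
    refine ⟨⌊t + K⌋₊, ?_, ?_⟩
    · rw [Nat.floor_lt (by linarith)]
      push_cast
      linarith
    · have h1 := Nat.floor_le (show 0 ≤ t + K by linarith)
      have h2 := Nat.lt_floor_add_one (t + K)
      rw [abs_le]
      constructor <;> linarith
  obtain ⟨a, ha, ha'⟩ := key _ ((RCLike.abs_re_le_norm z).trans hz)
  obtain ⟨b, hb, hb'⟩ := key _ ((RCLike.abs_im_le_norm z).trans hz)
  refine ⟨a, ha, b, hb, ?_⟩
  have e : ((a : 𝕜) - K) + ((b : 𝕜) - K) * RCLike.I - z =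
      (((a : ℝ) - K - RCLike.re z : ℝ) : 𝕜) + (((b : ℝ) - K - RCLike.im z : ℝ) : 𝕜) * RCLike.I := by
    conv_lhs => rw [← RCLike.re_add_im z]
    push_cast
    ring
  have hI : ‖(RCLike.I : 𝕜)‖ ≤ 1 := by
    rw [RCLike.norm_I]
    split_ifs <;> norm_num
  rw [e]
  refine (norm_add_le _ _).trans ?_
  rw [norm_mul, RCLike.norm_ofReal, RCLike.norm_ofReal]
  have := mul_le_mul hb' hI (norm_nonneg _) zero_le_one
  linarith

/-- The lattice pair with index `i < (2 * K + 1) ^ (L * 4)`: the base `2 * K + 1` digits of `i`,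
shifted by `-K`, are the real and imaginary parts of the coordinates of two lattice vectors. -/
theorem exists_lattice_pair_near {v : ℕ → V} {L : ℕ}
    (hv : Submodule.span 𝕜 (Set.range fun j : Fin L => v j) = ⊤) :
    ∃ R D : ℕ, ∀ (M : ℕ) (x y : V), ‖x‖ ≤ 1 → ‖y‖ ≤ 1 →
      ∃ i < (2 * (R * M) + 1) ^ (L * 4),
        ‖∑ j : Fin L, (gaussCode (baseDigit (2 * (R * M) + 1) i (j * 4)) (R * M)
          (baseDigit (2 * (R * M) + 1) i (j * 4 + 1)) (R * M)).val 𝕜 • v j - (M : 𝕜) • x‖ ≤ D ∧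
        ‖∑ j : Fin L, (gaussCode (baseDigit (2 * (R * M) + 1) i (j * 4 + 2)) (R * M)
          (baseDigit (2 * (R * M) + 1) i (j * 4 + 3)) (R * M)).val 𝕜 • v j - (M : 𝕜) • y‖ ≤ D := by
  -- The spanning vectors may be dependent; a linear right inverse of the combination map chooses
  -- coefficients, and in finite dimension it is bounded.
  obtain ⟨R, hR⟩ : ∃ R : ℕ, ∀ x : V, ‖x‖ ≤ 1 →
      ∃ c : Fin L → 𝕜, (∀ j, ‖c j‖ ≤ R) ∧ ∑ j, c j • v j = x := by
    have := FiniteDimensional.span_of_finite 𝕜 (Set.finite_range fun j : Fin L => v j)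
    rw [hv] at this
    have : FiniteDimensional 𝕜 V := Module.finite_def.2 (Module.Finite.iff_fg.1 this)
    obtain ⟨g, hg⟩ := (Fintype.linearCombination 𝕜 fun j : Fin L => v j)
      |>.exists_rightInverse_of_surjective (by rw [Fintype.range_linearCombination, hv])
    let G := LinearMap.toContinuousLinearMap g
    obtain ⟨R, hR⟩ := exists_nat_ge ‖G‖
    refine ⟨R, fun x hx => ⟨g x, fun j => ?_, ?_⟩⟩
    · calc ‖g x j‖ ≤ ‖G x‖ := norm_le_pi_norm (g x) j
        _ ≤ ‖G‖ * 1 := G.le_opNorm_of_le hx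
        _ ≤ R := by rwa [mul_one]
    · simpa [Fintype.linearCombination_apply] using LinearMap.congr_fun hg x
  -- Rounding moves each coefficient by at most 2.
  obtain ⟨D, hD⟩ := exists_nat_ge (∑ j : Fin L, 2 * ‖v j‖)
  refine ⟨R, D, fun M x y hx hy => ?_⟩
  have hbd : ∀ c : 𝕜, ‖c‖ ≤ R → ‖(M : 𝕜) * c‖ ≤ (R * M : ℕ) := fun c hc => by
    rw [norm_mul, RCLike.norm_natCast, Nat.cast_mul, mul_comm]
    exact mul_le_mul_of_nonneg_right hc (Nat.cast_nonneg M)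
  obtain ⟨cx, hcx, rfl⟩ := hR x hx
  obtain ⟨cy, hcy, rfl⟩ := hR y hy
  choose a ha b hb hab using fun j => exists_gauss_near (R * M) _ (hbd _ (hcx j))
  choose a' ha' b' hb' hab' using fun j => exists_gauss_near (R * M) _ (hbd _ (hcy j))
  generalize R * M = K at *
  obtain ⟨i, hi, hd⟩ := exists_baseDigit_eq (m := 2 * K + 1) (n := L * 4)
    (fun k => ![a k.divNat, b k.divNat, a' k.divNat, b' k.divNat] k.modNat) (fun k => by
      generalize k.modNat = l
      fin_cases l <;> simp [ha, hb, ha', hb'])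
  have hdig : ∀ (j : Fin L) (l : Fin 4),
      baseDigit (2 * K + 1) i (j * 4 + l) = ![a j, b j, a' j, b' j] l := fun j l => by
    have h := hd ⟨j * 4 + l, by omega⟩
    have h1 : (⟨j * 4 + l, by omega⟩ : Fin (L * 4)).divNat = j := by
      ext; simp [Fin.divNat]; omega
    have h2 : (⟨j * 4 + l, by omega⟩ : Fin (L * 4)).modNat = l := by
      ext; simp [Fin.modNat]
    rw [h1, h2] at h
    exact h
  have hsum : ∀ c d : Fin L → 𝕜, (∀ j, ‖d j - (M : 𝕜) * c j‖ ≤ 2) →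
      ‖∑ j, d j • v j - (M : 𝕜) • ∑ j, c j • v j‖ ≤ D := fun c d h => by
    rw [Finset.smul_sum, ← Finset.sum_sub_distrib]
    refine (norm_sum_le _ _).trans (le_trans (Finset.sum_le_sum fun j _ => ?_) hD)
    rw [smul_smul, ← sub_smul, norm_smul]
    exact mul_le_mul_of_nonneg_right (h j) (norm_nonneg _)
  refine ⟨i, hi, hsum _ _ fun j => ?_, hsum _ _ fun j => ?_⟩
  · have h0 := hdig j 0
    have h1 := hdig j 1
    simp only [Fin.isValue, Fin.val_zero, Fin.val_one, add_zero, Matrix.cons_val] at h0 h1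
    rw [val_gaussCode, h0, h1]
    exact hab j
  · have h0 := hdig j 2
    have h1 := hdig j 3
    simp only [Fin.isValue, Fin.val_two, Matrix.cons_val] at h0 h1
    rw [val_gaussCode, h0, show baseDigit (2 * K + 1) i (j * 4 + 3) = b' j from h1]
    exact hab' j

end lattice

/-! ### From a computable presentation to the exponent. -/

theorem primrec_baseDigit {α : Type*} [Primcodable α] {m i j : α → ℕ} (hm : Primrec m)
    (hi : Primrec i) (hj : Primrec j) : Primrec fun a => baseDigit (m a) (i a) (j a) :=
  Primrec.nat_mod.comp (Primrec.nat_div.comp hi (primrec_nat_pow.comp hm hj)) hm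

theorem primrec_gaussCode {α : Type*} [Primcodable α] {a b c d : α → ℕ} (ha : Primrec a)
    (hb : Primrec b) (hc : Primrec c) (hd : Primrec d) :
    Primrec fun x => gaussCode (a x) (b x) (c x) (d x) :=
  (ha.pair (hb.pair (Primrec.const 0))).pair (hc.pair (hd.pair (Primrec.const 0)))

theorem BanachPresentation.IsComputable.hasComputableCuts {𝕜 : Type*} [RCLike 𝕜] {V : Type*}
    [NormedAddCommGroup V] [NormedSpace 𝕜 V] [CompleteSpace V] [FiniteDimensional 𝕜 V]
    {P : BanachPresentation 𝕜 V} (hP : P.IsComputable) {θ : ℝ} (hJ : HasJamesExponent V θ) :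
    HasComputableCuts θ := by
  obtain ⟨f, hf, hfP⟩ := hP
  obtain ⟨L, hL⟩ := exists_span_range_fin_eq_top P.linearly_dense
  obtain ⟨R, D, hnet⟩ := exists_lattice_pair_near hL
  let dig : ℕ → (ℕ × ℕ) × ℕ → ℕ := fun r z => baseDigit (2 * z.1.1 + 1) z.1.2 (z.2 * 4 + r)
  have hdig : ∀ r, Primrec (dig r) := fun r => primrec_baseDigit
    (Primrec.succ.comp (Primrec.nat_mul.comp (Primrec.const 2)
      (Primrec.fst.comp Primrec.fst))) (Primrec.snd.comp Primrec.fst)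
    (Primrec.nat_add.comp (Primrec.nat_mul.comp Primrec.snd (Primrec.const 4)) (Primrec.const r))
  have hK : Primrec fun z : (ℕ × ℕ) × ℕ => z.1.1 := Primrec.fst.comp Primrec.fst
  let vec : ((ℕ × ℕ) × ℕ → ScalarCode) → ℕ × ℕ → V :=
    fun h z => ∑ j : Fin L, (h (z, j)).val 𝕜 • P.vec j
  let g : ((ℕ × ℕ) × ℕ → ScalarCode) → ℕ × ℕ → ℕ :=
    fun h z => (f 0 ((List.range L).map fun j => h (z, j))).natPart
  have hg : ∀ h, Primrec h → Computable (g h) := fun h hh =>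
    RatCode.computable_natPart.comp (hf.comp (Computable.const 0)
      (Primrec.list_map (Primrec.const (List.range L)) hh.to₂).to_comp)
  have hgv : ∀ h z, |(g h z : ℝ) - ‖vec h z‖| ≤ 2 := fun h z => by
    refine RatCode.abs_natPart_sub_le (norm_nonneg _) ?_
    have := hfP 0 ((List.range L).map fun j => h (z, j))
    rwa [pow_zero, div_one, P.ratVec_map_range] at this
  let hx : (ℕ × ℕ) × ℕ → ScalarCode := fun z => gaussCode (dig 0 z) z.1.1 (dig 1 z) z.1.1
  let hy : (ℕ × ℕ) × ℕ → ScalarCode := fun z => gaussCode (dig 2 z) z.1.1 (dig 3 z) z.1.1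
  -- Sums and differences must be coded directly, since the algorithm evaluates norms from codes. In
  -- the sum the shift doubles; in the difference it cancels.
  let hp : (ℕ × ℕ) × ℕ → ScalarCode := fun z =>
    gaussCode (dig 0 z + dig 2 z) (z.1.1 + z.1.1) (dig 1 z + dig 3 z) (z.1.1 + z.1.1)
  let hm : (ℕ × ℕ) × ℕ → ScalarCode := fun z =>
    gaussCode (dig 0 z) (dig 2 z) (dig 1 z) (dig 3 z)
  have hadd : ∀ z, vec hx z + vec hy z = vec hp z := fun z => by
    simp only [vec, ← Finset.sum_add_distrib, ← add_smul, hx, hy, hp, val_gaussCode]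
    refine Finset.sum_congr rfl fun j _ => ?_
    congr 1
    push_cast
    ring
  have hsub : ∀ z, vec hx z - vec hy z = vec hm z := fun z => by
    simp only [vec, ← Finset.sum_sub_distrib, ← sub_smul, hx, hy, hm, val_gaussCode]
    refine Finset.sum_congr rfl fun j _ => ?_
    congr 1
    ring
  refine hJ.hasComputableCuts (𝕜 := 𝕜) (X := vec hx) (Y := vec hy) (hg hx ?_) (hg hy ?_)
    (hg hp ?_) (hg hm ?_) (hgv hx) (hgv hy) (fun z => hadd z ▸ hgv hp z)
    (fun z => hsub z ▸ hgv hm z) R D (L * 4) hnet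
  · exact primrec_gaussCode (hdig 0) hK (hdig 1) hK
  · exact primrec_gaussCode (hdig 2) hK (hdig 3) hK
  · exact primrec_gaussCode (Primrec.nat_add.comp (hdig 0) (hdig 2)) (Primrec.nat_add.comp hK hK)
      (Primrec.nat_add.comp (hdig 1) (hdig 3)) (Primrec.nat_add.comp hK hK)
  · exact primrec_gaussCode (hdig 0) (hdig 2) (hdig 1) (hdig 3)

theorem mainTheorem3 (𝕜 : Type*) [RCLike 𝕜] (n : ℕ) (hn : 2 ≤ n) (p : ℝ) [Fact (1 ≤ p)]
    (h : IsComputablyPresentable 𝕜 (FiniteEllp 𝕜 p n)) : IsComputableReal p := by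
  obtain ⟨P, hP⟩ := h
  -- The case `p = 1` is split off because the search for cuts needs room strictly between 1 and
  -- `p`.
  rcases (Fact.out : 1 ≤ p).eq_or_lt with rfl | h1
  · exact isComputableReal_one
  rcases le_total p 2 with h2 | h2
  · exact (hP.hasComputableCuts (FiniteEllp.hasJamesExponent_of_le_two hn h2)).of_inv h1
  · exact (hP.hasComputableCuts (FiniteEllp.hasJamesExponent_of_two_le hn h2)).of_one_sub_inv h1
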